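/- Let $(\Omega,\mathcal F,P)$ be a probability space and let $\varphi:\mathbb R\to\mathbb R$ be an Orlicz N-function (even, convex, continuous, $\varphi(0)=0$, $\varphi(x)>0$ for $x\ne0$, $\varphi(x)/x\to0$ as $x\to0$, $\varphi(x)/x\to\infty$ as $x\to\infty$) for which $\lim_{x\to0}\varphi(x)/x^2$ exists in $(0,+\infty]$, and which belongs to the class $C_I$, that is, $\varphi(t)=t^\zeta/\zeta$ for $t>1$ with some $\zeta\ge2$. A random variable $\eta$ belongs to $\mathrm{Sub}_\varphi(\Omega)$ if there is $a\ge0$ with $E e^{\lambda\eta}\le e^{\varphi(a\lambda)}$ for all $\lambda\in\mathbb R$; $\tau_\varphi(\eta)$ denotes the infimum of such $a$. A process belongs to $\mathrm{Sub}_\varphi(\Omega)$ if all its values do. Let $T>0$, $C>0$, $\alpha\in(0,1)$. Let $X=\{X(t),t\in[0,T]\}$ be a separable process from $\mathrm{Sub}_\varphi(\Omega)$ such that $$\sup_{|t-s|\le h}\tau_\varphi(X(t)-X(s))\le C h^\alpha\qquad(h>0),\tag{$*$}$$ and let $X(t)=\sum_{k=0}^\infty\xi_k a_k(t)$, where $\xi_k$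 are random variables, $a_k$ are real functions on $[0,T]$ and the series converges in mean square for every $t\in[0,T]$. Fix $N$ and let the model $X_N(t)=\sum_{k=0}^N\xi_k a_k(t)$ belong to $\mathrm{Sub}_\varphi(\Omega)$. Put $\Delta_N=X-X_N$. Suppose that the $\xi_k$ are independent, or, if they are not, that $\Delta_N$ also satisfies $(*)$ in place of $X$. Put $$\beta=C(T/2)^\alpha,\qquad \gamma_N=\Bigl(\sup_{u\in[0,T]}\tau_\varphi^\zeta(\Delta_N(u))\Bigr)^{1/\zeta},\qquad v=\min\{\beta,\gamma_N\},$$ and suppose that $\gamma_N>0$. If $$\delta>\frac{\gamma_N(v^{\zeta-1}+1)+\sqrt{\gamma_N^2(v^{\zeta-1}+1)^2+4v^{\zeta-1}\bigl(C^\zeta(T/2)^{\alpha\zeta}-\gamma_N^2\bigr)}}{2v^{\zeta-1}}$$ and $$\nu\ge 2\exp\left\{-\frac{(\zeta-1)\,\delta^{\frac1{\zeta-1}}(\delta-\gamma_N)^{\frac{\zeta}{\zeta-1}}}{\zeta\bigl(\gamma_N^\zeta(\delta-\gamma_N)+\beta^\zeta\gamma_N\bigr)^{\frac1{\zeta-1}}}\right\}\cdot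 2\left(\frac{e\,\delta}{\min\{1,\gamma_N\}}\right)^{1/\alpha},$$ then $X_N$ approximates $X$ with reliability $1-\nu$ and accuracy $\delta$ in $C(0,T)$, that is, $$P\Bigl\{\sup_{t\in[0,T]}|\Delta_N(t)|>\delta\Bigr\}\le\nu .$$ -/

import Mathlib

open MeasureTheory ProbabilityTheory Filter Topology

/-- Orlicz N-functions. -/
structure IsOrliczNFunction (φ : ℝ → ℝ) : Prop where
  even : ∀ x, φ (-x) = φ x
  convex : ConvexOn ℝ Set.univ φ
  continuous : Continuous φ
  map_zero : φ 0 = 0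
  pos : ∀ x, x ≠ 0 → 0 < φ x
  tendsto_zero : Tendsto (fun x => φ x / x) (𝓝[≠] 0) (𝓝 0)
  tendsto_top : Tendsto (fun x => φ x / x) atTop atTop

/-- Assumption Q: the limit of `φ x / x ^ 2` at `0` exists and is positive, possibly `+∞`. -/
def AssumptionQ (φ : ℝ → ℝ) : Prop :=
  ∃ c : EReal, 0 < c ∧ Tendsto (fun x : ℝ => ((φ x / x ^ 2 : ℝ) : EReal)) (𝓝[≠] 0) (𝓝 c)

/-- The class `C_I` with exponent `ζ`: N-functions satisfying assumption Q that are equal to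
`t ^ ζ / ζ` for `t > 1`, where `ζ ≥ 2`. -/
structure IsClassI (φ : ℝ → ℝ) (ζ : ℝ) : Prop where
  nFunction : IsOrliczNFunction φ
  assumptionQ : AssumptionQ φ
  two_le : 2 ≤ ζ
  eq_rpow : ∀ t, 1 < t → φ t = t ^ ζ / ζ

section

variable {Ω : Type*} [MeasurableSpace Ω]

/-- `a ≥ 0` and `E exp (l ξ) ≤ exp (φ (a l))` for every real `l`
(the expectation being finite). -/
def IsSubPhiBound (φ : ℝ → ℝ) (P : Measure Ω) (ξ : Ω → ℝ) (a : ℝ) : Prop :=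
  0 ≤ a ∧ ∀ l : ℝ, Integrable (fun ω => Real.exp (l * ξ ω)) P ∧
    ∫ ω, Real.exp (l * ξ ω) ∂P ≤ Real.exp (φ (a * l))

/-- `ξ` is a `φ`-sub-Gaussian random variable, that is, `ξ ∈ Sub_φ(Ω)`. -/
def MemSubPhi (φ : ℝ → ℝ) (P : Measure Ω) (ξ : Ω → ℝ) : Prop :=
  ∃ a, IsSubPhiBound φ P ξ a

/-- The `φ`-sub-Gaussian standard `τ_φ(ξ)`. -/
noncomputable def tauPhi (φ : ℝ → ℝ) (P : Measure Ω) (ξ : Ω → ℝ) : ℝ :=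
  sInf {a | IsSubPhiBound φ P ξ a}

/-- The process `X` on `[0, T]` belongs to `Sub_φ(Ω)`. -/
def ProcessSubPhi (φ : ℝ → ℝ) (P : Measure Ω) (T : ℝ) (X : ℝ → Ω → ℝ) : Prop :=
  ∀ t ∈ Set.Icc 0 T, MemSubPhi φ P (X t)

/-- Separability of a process on `[0, T]`: there are a countable set `S` of times and a null set
outside of which, for every open `G` and closed `F`, the values on `G ∩ [0, T]` lie in `F` as soon
as the values on `G ∩ S` do. -/
def SeparableProcess (P : Measure Ω) (T : ℝ) (X : ℝ → Ω → ℝ) : Prop :=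
  ∃ S : Set ℝ, S.Countable ∧ S ⊆ Set.Icc 0 T ∧
    ∀ᵐ ω ∂P, ∀ G F : Set ℝ, IsOpen G → IsClosed F →
      (∀ s ∈ G ∩ S, X s ω ∈ F) → ∀ t ∈ G ∩ Set.Icc 0 T, X t ω ∈ F

/-- `sup_{|t - s| ≤ h} τ_φ(X(t) - X(s)) ≤ σ(h)` for every `h > 0`. -/
def IncrementsBoundedBy (φ : ℝ → ℝ) (P : Measure Ω) (T : ℝ) (X : ℝ → Ω → ℝ)
    (σ : ℝ → ℝ) : Prop :=
  ∀ h, 0 < h → ∀ t ∈ Set.Icc 0 T, ∀ s ∈ Set.Icc 0 T, |t - s| ≤ h →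
    tauPhi φ P (fun ω => X t ω - X s ω) ≤ σ h

/-- The sum `∑_{k = 0}^N ξ_k a_k(t)`. -/
def modelProcess (ξ : ℕ → Ω → ℝ) (a : ℕ → ℝ → ℝ) (N : ℕ) (t : ℝ) (ω : Ω) : ℝ :=
  ∑ k ∈ Finset.range (N + 1), ξ k ω * a k t

/-- `X(t) = ∑_{k = 0}^∞ ξ_k a_k(t)` on `[0, T]`, the series converging in mean square. -/
def HasSeriesRepresentation (P : Measure Ω) (T : ℝ) (X : ℝ → Ω → ℝ) (ξ : ℕ → Ω → ℝ)
    (a : ℕ → ℝ → ℝ) : Prop :=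
  ∀ t ∈ Set.Icc 0 T,
    Tendsto (fun n => eLpNorm (fun ω => X t ω - modelProcess ξ a n t ω) 2 P) atTop (𝓝 0)

/-- `Y` approximates `X` with reliability `1 - ν` and accuracy `δ` in `C(0, T)`:
`P {sup_{t ∈ [0, T]} |X(t) - Y(t)| > δ} ≤ ν`, the supremum being allowed to be `+∞`. -/
def ApproximatesWith (P : Measure Ω) (T : ℝ) (X Y : ℝ → Ω → ℝ) (ν δ : ℝ) : Prop :=
  P {ω | (δ : EReal) < ⨆ t ∈ Set.Icc 0 T, ((|X t ω - Y t ω| : ℝ) : EReal)} ≤ ENNReal.ofReal ν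

end

/-- The larger root of `v x² - γ (v + 1) x + γ² - β ^ ζ`, where `v = (min β γ) ^ (ζ - 1)`. -/
noncomputable def accuracyThreshold (ζ β γ : ℝ) : ℝ :=
  (γ * ((min β γ) ^ (ζ - 1) + 1) +
      √(γ ^ 2 * ((min β γ) ^ (ζ - 1) + 1) ^ 2 + 4 * (min β γ) ^ (ζ - 1) * (β ^ ζ - γ ^ 2))) /
    (2 * (min β γ) ^ (ζ - 1))

/-- The bound for the probability of the one-sided deviation `x`. -/
noncomputable def deviationBound (ζ α β γ x : ℝ) : ℝ :=
  Real.exp (-((ζ - 1) * x ^ (1 / (ζ - 1)) * (x - γ) ^ (ζ / (ζ - 1)) /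
      (ζ * (γ ^ ζ * (x - γ) + β ^ ζ * γ) ^ (1 / (ζ - 1))))) *
    (2 * (Real.exp 1 * x / min 1 γ) ^ (1 / α))

/-! Write Δ = X - X_N and β = C(T/2)^α. Every Δ(t) has standard at most γ, and the increments of Δ
have standard at most C h^α; in the independent case this is inherited from X, because splitting off
an independent centred summand can only lower exponential moments
(`incrementsBoundedBy_remainder_of_iIndepFun`).

The tail is bounded by chaining (`measure_exists_lt_le`). For 0 < p < 1 take nets of [0, T] whose
links at level j ≥ 1 have length at most (T/2) p^(j/α), hence standard at most β p^j. Hölder's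
inequality with weights (1 - p) p^j separates the levels. Standard divided by weight is then γ/(1-p)
at level 0 and β/(1-p) at every later level, so the exponent collapses to two terms, with total
weights 1 - p and p. The net sizes contribute at most (3/2)(e/p)^(1/α).

Taking p = γ/δ and the optimal Chernoff parameter l gives the stated exponent when φ is the pure
power s^ζ/ζ. A function of class C_I exceeds that power by at most 1/4 for s ≥ 0, and e^(1/4) · 3/2
≤ 2 absorbs the loss. The accuracy condition ensures γ < δ, that is, p < 1. Applying the bound to Δ
and -Δ gives the outer factor 2.

Passing from a countable set to [0, T] needs an argument, since separability is assumed for X only.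
The model is a finite linear combination of random variables and is continuous in L¹, so almost
surely its paths are continuous; subtracting it then preserves the control by a countable set. -/

/-! ### Elementary properties of N-functions. -/

namespace IsOrliczNFunction

variable {φ : ℝ → ℝ}

theorem nonneg (h : IsOrliczNFunction φ) (x : ℝ) : 0 ≤ φ x := by
  rcases eq_or_ne x 0 with rfl | hx
  · exact h.map_zero.ge
  · exact (h.pos x hx).le

theorem apply_abs (h : IsOrliczNFunction φ) (x : ℝ) : φ |x| = φ x := by
  rcases abs_choice x with hx | hx <;> rw [hx]
  exact h.even x

theorem monotoneOn (h : IsOrliczNFunction φ) : MonotoneOn φ (Set.Ici 0) := by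
  intro x hx y hy hxy
  rw [Set.mem_Ici] at hx hy
  rcases hy.eq_or_lt with rfl | hy'
  · rw [le_antisymm hxy hx]
  have hw : x / y ≤ 1 := div_le_one_of_le₀ hxy hy
  have hc := h.convex.2 (Set.mem_univ y) (Set.mem_univ 0) (div_nonneg hx hy)
    (sub_nonneg.2 hw) (by ring)
  simp only [smul_eq_mul, mul_zero, add_zero, h.map_zero, div_mul_cancel₀ x hy'.ne'] at hc
  exact hc.trans (mul_le_of_le_one_left (h.nonneg y) hw)

theorem le_of_abs_le (h : IsOrliczNFunction φ) {x y : ℝ} (hxy : |x| ≤ |y|) : φ x ≤ φ y := by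
  rw [← h.apply_abs x, ← h.apply_abs y]
  exact h.monotoneOn (abs_nonneg x) (abs_nonneg y) hxy

theorem hasDerivAt_zero (h : IsOrliczNFunction φ) : HasDerivAt φ 0 0 := by
  rw [hasDerivAt_iff_tendsto_slope]
  refine h.tendsto_zero.congr fun x => ?_
  simp [slope_def_field, h.map_zero]

end IsOrliczNFunction

/-! ### The φ-sub-Gaussian standard. -/

section SubPhi

variable {Ω : Type*} [MeasurableSpace Ω] {P : Measure Ω} {φ : ℝ → ℝ} {ξ η : Ω → ℝ} {a b : ℝ}

theorem IsSubPhiBound.mono (h : IsSubPhiBound φ P ξ a) (hφ : IsOrliczNFunction φ) (hab : a ≤ b) :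
    IsSubPhiBound φ P ξ b := by
  refine ⟨h.1.trans hab, fun l => ⟨(h.2 l).1, (h.2 l).2.trans (Real.exp_le_exp.2 ?_)⟩⟩
  refine hφ.le_of_abs_le ?_
  rw [abs_mul, abs_mul, abs_of_nonneg h.1, abs_of_nonneg (h.1.trans hab)]
  gcongr

theorem IsSubPhiBound.neg (h : IsSubPhiBound φ P ξ a) (hφ : IsOrliczNFunction φ) :
    IsSubPhiBound φ P (fun ω => -ξ ω) a := by
  refine ⟨h.1, fun l => ?_⟩
  have := h.2 (-l)
  simp only [mul_neg, hφ.even] at this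
  simpa using this

theorem IsSubPhiBound.aemeasurable (h : IsSubPhiBound φ P ξ a) : AEMeasurable ξ P := by
  have := Real.measurable_log.comp_aemeasurable (h.2 1).1.aestronglyMeasurable.aemeasurable
  simpa [Function.comp_def] using this

/-- Convexity of exp with weights a/(a+b) and b/(a+b): after dividing l by its weight, both
arguments of φ become ±(a+b)l. -/
theorem IsSubPhiBound.sub (hξ : IsSubPhiBound φ P ξ a) (hη : IsSubPhiBound φ P η b)
    (hφ : IsOrliczNFunction φ) (ha : 0 < a) (hb : 0 < b) :
    IsSubPhiBound φ P (fun ω => ξ ω - η ω) (a + b) := by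
  refine ⟨by positivity, fun l => ?_⟩
  have hab : 0 < a + b := by positivity
  set w := a / (a + b) with hw
  set v := b / (a + b) with hv
  have hw0 : 0 < w := by positivity
  have hv0 : 0 < v := by positivity
  have hwv : w + v = 1 := by rw [hw, hv]; field_simp
  have e1 := hξ.2 (l / w)
  have e2 := hη.2 (-(l / v))
  have f1 : a * (l / w) = (a + b) * l := by rw [hw]; field_simp
  have f2 : b * -(l / v) = -((a + b) * l) := by rw [hv]; field_simp
  rw [f1] at e1
  rw [f2, hφ.even] at e2
  have key : ∀ ω, Real.exp (l * (ξ ω - η ω)) ≤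
      w * Real.exp (l / w * ξ ω) + v * Real.exp (-(l / v) * η ω) := by
    intro ω
    have := convexOn_exp.2 (Set.mem_univ (l / w * ξ ω)) (Set.mem_univ (-(l / v) * η ω))
      hw0.le hv0.le hwv
    simp only [smul_eq_mul] at this
    rwa [show w * (l / w * ξ ω) + v * (-(l / v) * η ω) = l * (ξ ω - η ω) by
      rw [← mul_assoc, mul_div_cancel₀ l hw0.ne', ← mul_assoc, mul_neg, mul_div_cancel₀ l hv0.ne']
      ring] at this
  have hint : Integrable (fun ω => w * Real.exp (l / w * ξ ω) +
      v * Real.exp (-(l / v) * η ω)) P := (e1.1.const_mul w).add (e2.1.const_mul v)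
  have hint' : Integrable (fun ω => Real.exp (l * (ξ ω - η ω))) P := by
    refine hint.mono' ?_ (ae_of_all _ fun ω => ?_)
    · exact (Real.measurable_exp.comp_aemeasurable
        ((hξ.aemeasurable.sub hη.aemeasurable).const_mul l)).aestronglyMeasurable
    · rw [Real.norm_eq_abs, Real.abs_exp]
      exact key ω
  refine ⟨hint', (integral_mono hint' hint key).trans ?_⟩
  rw [integral_add (e1.1.const_mul w) (e2.1.const_mul v), integral_const_mul, integral_const_mul]
  calc w * _ + v * _ ≤ w * Real.exp (φ ((a + b) * l)) + v * Real.exp (φ ((a + b) * l)) := by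
        gcongr
        · exact e1.2
        · exact e2.2
    _ = Real.exp (φ ((a + b) * l)) := by rw [← add_mul, hwv, one_mul]

theorem MemSubPhi.exists_pos (h : MemSubPhi φ P ξ) (hφ : IsOrliczNFunction φ) :
    ∃ a, 0 < a ∧ IsSubPhiBound φ P ξ a := by
  obtain ⟨a, ha⟩ := h
  exact ⟨a + 1, by linarith [ha.1], ha.mono hφ (by linarith)⟩

theorem MemSubPhi.sub (hξ : MemSubPhi φ P ξ) (hη : MemSubPhi φ P η)
    (hφ : IsOrliczNFunction φ) : MemSubPhi φ P (fun ω => ξ ω - η ω) := by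
  obtain ⟨a, ha, hξ⟩ := hξ.exists_pos hφ
  obtain ⟨b, hb, hη⟩ := hη.exists_pos hφ
  exact ⟨a + b, hξ.sub hη hφ ha hb⟩

/-- The infimum defining `tauPhi` is attained. -/
theorem MemSubPhi.isSubPhiBound_tauPhi (h : MemSubPhi φ P ξ) (hφ : IsOrliczNFunction φ) :
    IsSubPhiBound φ P ξ (tauPhi φ P ξ) := by
  have hne : {a | IsSubPhiBound φ P ξ a}.Nonempty := h
  have h0 : 0 ≤ tauPhi φ P ξ := le_csInf hne fun a ha => ha.1
  refine ⟨h0, fun l => ⟨(h.choose_spec.2 l).1, ?_⟩⟩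
  have ht : Tendsto (fun b => Real.exp (φ (b * l))) (𝓝[>] tauPhi φ P ξ)
      (𝓝 (Real.exp (φ (tauPhi φ P ξ * l)))) := by
    have : Continuous fun b => Real.exp (φ (b * l)) :=
      Real.continuous_exp.comp (hφ.continuous.comp (by fun_prop))
    exact (this.tendsto _).mono_left nhdsWithin_le_nhds
  refine ge_of_tendsto ht ?_
  filter_upwards [self_mem_nhdsWithin] with b hb
  obtain ⟨a, ha, hab⟩ := exists_lt_of_csInf_lt hne (show sInf _ < b from hb)
  exact ((IsSubPhiBound.mono ha hφ hab.le).2 l).2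

theorem MemSubPhi.isSubPhiBound (h : MemSubPhi φ P ξ) (hφ : IsOrliczNFunction φ)
    (hb : tauPhi φ P ξ ≤ b) : IsSubPhiBound φ P ξ b :=
  (h.isSubPhiBound_tauPhi hφ).mono hφ hb

theorem IsSubPhiBound.tauPhi_le (h : IsSubPhiBound φ P ξ a) : tauPhi φ P ξ ≤ a :=
  csInf_le ⟨0, fun _ hb => hb.1⟩ h

theorem abs_le_exp_add_exp_neg (x : ℝ) : |x| ≤ Real.exp x + Real.exp (-x) := by
  rcases abs_cases x with h | h <;>
  linarith [Real.add_one_le_exp x, Real.add_one_le_exp (-x), Real.exp_pos x, Real.exp_pos (-x)]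

theorem IsSubPhiBound.integrable (h : IsSubPhiBound φ P ξ a) : Integrable ξ P := by
  refine ((h.2 1).1.add (h.2 (-1)).1).mono' h.aemeasurable.aestronglyMeasurable
    (ae_of_all _ fun ω => ?_)
  simpa using abs_le_exp_add_exp_neg (ξ ω)

theorem IsSubPhiBound.integral_abs_le (h : IsSubPhiBound φ P ξ a) (hφ : IsOrliczNFunction φ)
    (ha : 0 < a) : ∫ ω, |ξ ω| ∂P ≤ 2 * Real.exp (φ 1) * a := by
  have e1 := h.2 a⁻¹
  have e2 := h.2 (-a⁻¹)
  rw [mul_inv_cancel₀ ha.ne'] at e1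
  rw [mul_neg, mul_inv_cancel₀ ha.ne', hφ.even] at e2
  have hint : Integrable (fun ω => a * (Real.exp (a⁻¹ * ξ ω) + Real.exp (-a⁻¹ * ξ ω))) P :=
    (e1.1.add e2.1).const_mul a
  calc ∫ ω, |ξ ω| ∂P ≤ ∫ ω, a * (Real.exp (a⁻¹ * ξ ω) + Real.exp (-a⁻¹ * ξ ω)) ∂P := by
        refine integral_mono h.integrable.abs hint fun ω => ?_
        have := abs_le_exp_add_exp_neg (a⁻¹ * ξ ω)
        rw [abs_mul, abs_of_pos (inv_pos.2 ha), inv_mul_le_iff₀ ha] at this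
        simpa using this
    _ = a * (∫ ω, Real.exp (a⁻¹ * ξ ω) ∂P + ∫ ω, Real.exp (-a⁻¹ * ξ ω) ∂P) := by
        rw [integral_const_mul, integral_add e1.1 e2.1]
    _ ≤ a * (Real.exp (φ 1) + Real.exp (φ 1)) := by
        gcongr
        · exact e1.2
        · exact e2.2
    _ = 2 * Real.exp (φ 1) * a := by ring

/-- From 1 + l E ξ ≤ E exp(l ξ) ≤ exp(φ(a l)), the difference of the outer terms has a minimum at l
= 0. Since φ'(0) = 0, its derivative there is -E ξ. -/
theorem IsSubPhiBound.integral_eq_zero [IsProbabilityMeasure P] (h : IsSubPhiBound φ P ξ a)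
    (hφ : IsOrliczNFunction φ) : ∫ ω, ξ ω ∂P = 0 := by
  set g : ℝ → ℝ := fun l => Real.exp (φ (a * l)) - (1 + l * ∫ ω, ξ ω ∂P) with hg
  have hg0 : g 0 = 0 := by simp [hg, hφ.map_zero]
  have hge : ∀ l, 0 ≤ g l := by
    intro l
    have h1 : ∫ ω, (1 + l * ξ ω) ∂P = 1 + l * ∫ ω, ξ ω ∂P := by
      rw [integral_add (integrable_const _) (h.integrable.const_mul l), integral_const_mul]
      simp
    have h2 : ∫ ω, (1 + l * ξ ω) ∂P ≤ ∫ ω, Real.exp (l * ξ ω) ∂P :=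
      integral_mono ((integrable_const _).add (h.integrable.const_mul l)) (h.2 l).1 fun ω => by
        linarith [Real.add_one_le_exp (l * ξ ω)]
    simp only [hg]
    linarith [(h.2 l).2]
  have hmin : IsLocalMin g 0 := Filter.Eventually.of_forall fun l => by rw [hg0]; exact hge l
  have hd1 : HasDerivAt (fun l => φ (a * l)) (0 * a) 0 := by
    have h1 : HasDerivAt (fun l : ℝ => a * l) a 0 := by
      simpa using (hasDerivAt_id (0 : ℝ)).const_mul a
    have h2 : HasDerivAt φ 0 (a * 0) := by simpa using hφ.hasDerivAt_zero
    exact h2.comp 0 h1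
  have hd2 : HasDerivAt (fun l : ℝ => 1 + l * ∫ ω, ξ ω ∂P) (∫ ω, ξ ω ∂P) 0 := by
    simpa using ((hasDerivAt_id (0 : ℝ)).mul_const (∫ ω, ξ ω ∂P)).const_add 1
  have := hmin.hasDerivAt_eq_zero (hd1.exp.sub hd2)
  simpa using this

theorem IsSubPhiBound.one_le_integral_exp [IsProbabilityMeasure P] (h : IsSubPhiBound φ P ξ a)
    (hφ : IsOrliczNFunction φ) (l : ℝ) : 1 ≤ ∫ ω, Real.exp (l * ξ ω) ∂P := by
  have h1 : ∫ ω, (1 + l * ξ ω) ∂P = 1 := by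
    rw [integral_add (integrable_const _) (h.integrable.const_mul l), integral_const_mul,
      h.integral_eq_zero hφ]
    simp
  rw [← h1]
  exact integral_mono ((integrable_const _).add (h.integrable.const_mul l)) (h.2 l).1 fun ω => by
    linarith [Real.add_one_le_exp (l * ξ ω)]

end SubPhi

/-! ### Independent series: increments of the remainder. -/

section IndependentSeries

theorem measurable_limUnder_real {Ω : Type*} [MeasurableSpace Ω] {f : ℕ → Ω → ℝ}
    (hf : ∀ n, Measurable (f n)) : Measurable fun ω => limUnder atTop fun n => f n ω :=
  (StronglyMeasurable.limUnder fun n => (hf n).stronglyMeasurable).measurable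

theorem measurable_sum_mul_const {Ω : Type*} [MeasurableSpace Ω] {ξ : ℕ → Ω → ℝ} {s : Finset ℕ}
    (hξ : ∀ k ∈ s, Measurable (ξ k)) (c : ℕ → ℝ) : Measurable fun ω => ∑ k ∈ s, ξ k ω * c k :=
  Finset.measurable_fun_sum _ fun k hk => (hξ k hk).mul_const _

variable {Ω : Type*} [MeasurableSpace Ω] {P : Measure Ω}

/-- A partial sum of a mean square convergent series of independent random variables is independent
of the remainder. -/
theorem indepFun_sum_range_sub {ξ : ℕ → Ω → ℝ} (hξ : ∀ k, Measurable (ξ k)) (hind : iIndepFun ξ P)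
    (c : ℕ → ℝ) {Y : Ω → ℝ} (hY : AEMeasurable Y P)
    (hlim : Tendsto (fun n => eLpNorm (fun ω => Y ω - ∑ k ∈ Finset.range (n + 1), ξ k ω * c k) 2 P)
      atTop (𝓝 0)) (N : ℕ) :
    IndepFun (fun ω => ∑ k ∈ Finset.range (N + 1), ξ k ω * c k)
      (fun ω => Y ω - ∑ k ∈ Finset.range (N + 1), ξ k ω * c k) P := by
  set S : ℕ → Ω → ℝ := fun n ω => ∑ k ∈ Finset.range (n + 1), ξ k ω * c k with hS
  have hSm : ∀ n, Measurable (S n) := fun n =>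
    Finset.measurable_fun_sum _ fun k _ => (hξ k).mul_const _
  have hmeas : TendstoInMeasure P S atTop Y := by
    refine tendstoInMeasure_of_tendsto_eLpNorm (p := 2) (by norm_num)
      (fun n => (hSm n).aestronglyMeasurable) hY.aestronglyMeasurable (hlim.congr fun n => ?_)
    rw [← eLpNorm_neg]
    congr 1
    ext ω
    simp [hS]
  obtain ⟨ns, hns, hae⟩ := hmeas.exists_seq_tendsto_ae
  set m : ℕ → MeasurableSpace Ω := fun k => MeasurableSpace.comap (ξ k) inferInstance with hm
  set R : ℕ → Ω → ℝ := fun n ω => ∑ k ∈ Finset.Ico (N + 1) (n + 1), ξ k ω * c k with hR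
  -- A version of the remainder that is measurable exactly, not just up to a null set, with respect
  -- to the variables of index above N.
  set B : Ω → ℝ := fun ω => limUnder atTop fun i => R (ns i) ω with hB
  have hsub : ∀ (s : Set ℕ) (k : ℕ), k ∈ s → Measurable[⨆ i ∈ s, m i] (ξ k) := fun s k hk =>
    (comap_measurable (ξ k)).mono (le_iSup₂_of_le k hk le_rfl) le_rfl
  have hBm : Measurable[⨆ i ∈ Set.Ioi N, m i] B :=
    @measurable_limUnder_real Ω (⨆ i ∈ Set.Ioi N, m i) _ fun i =>
      @measurable_sum_mul_const Ω (⨆ i ∈ Set.Ioi N, m i) _ _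
        (fun k hk => hsub _ k (Nat.lt_of_succ_le (Finset.mem_Ico.1 hk).1)) _
  have hSN : Measurable[⨆ i ∈ Set.Iic N, m i] (S N) :=
    @measurable_sum_mul_const Ω (⨆ i ∈ Set.Iic N, m i) _ _
      (fun k hk => hsub _ k (Nat.lt_succ_iff.1 (Finset.mem_range.1 hk))) _
  have hdisj : Disjoint (Set.Iic N) (Set.Ioi N) := Set.Iic_disjoint_Ioi le_rfl
  have hI := indep_iSup_of_disjoint (fun i => (hξ i).comap_le) hind.iIndep hdisj
  have hSB : IndepFun (S N) B P := by
    rw [IndepFun_iff_Indep]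
    exact indep_of_indep_of_le_left (indep_of_indep_of_le_right hI hBm.comap_le) hSN.comap_le
  refine hSB.congr (ae_eq_refl _) ?_
  filter_upwards [hae] with ω hω
  have hR' : Tendsto (fun i => R (ns i) ω) atTop (𝓝 (Y ω - S N ω)) := by
    refine (hω.sub_const (S N ω)).congr' ?_
    filter_upwards [hns.tendsto_atTop.eventually_ge_atTop N] with i hi
    simp only [hS, hR]
    rw [Finset.sum_Ico_eq_sub _ (Nat.succ_le_succ hi)]
  exact hR'.limUnder_eq

variable {φ : ℝ → ℝ}

/-- Removing an independent centred summand does not increase the exponential moments. -/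
theorem IsSubPhiBound.of_add_of_indepFun [IsProbabilityMeasure P] (hφ : IsOrliczNFunction φ)
    {A B : Ω → ℝ} {b : ℝ} (hA : MemSubPhi φ P A) (hB : MemSubPhi φ P B) (hAB : IndepFun A B P)
    (h : IsSubPhiBound φ P (fun ω => A ω + B ω) b) : IsSubPhiBound φ P B b := by
  obtain ⟨a, hA⟩ := hA
  obtain ⟨c, hB⟩ := hB
  refine ⟨h.1, fun l => ⟨(hB.2 l).1, le_trans ?_ (h.2 l).2⟩⟩
  have hmul := hAB.mgf_add (t := l) (hA.2 l).1.aestronglyMeasurable (hB.2 l).1.aestronglyMeasurable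
  simp only [mgf, Pi.add_apply] at hmul
  rw [hmul]
  exact le_mul_of_one_le_left (integral_nonneg fun ω => (Real.exp_pos _).le)
    (hA.one_le_integral_exp hφ l)

/-- An increment of X is the sum of the independent increments of the model and of the remainder.
The former is centred, so by Jensen its exponential moments are at least 1 and can be dropped. -/
theorem incrementsBoundedBy_remainder_of_iIndepFun [IsProbabilityMeasure P]
    (hφ : IsOrliczNFunction φ) {T : ℝ} {X : ℝ → Ω → ℝ} {ξ : ℕ → Ω → ℝ} {a : ℕ → ℝ → ℝ} {N : ℕ}
    {σ : ℝ → ℝ} (hX : ProcessSubPhi φ P T X) (hinc : IncrementsBoundedBy φ P T X σ)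
    (hξ : ∀ k, Measurable (ξ k)) (hser : HasSeriesRepresentation P T X ξ a)
    (hXN : ProcessSubPhi φ P T (modelProcess ξ a N)) (hind : iIndepFun ξ P) :
    IncrementsBoundedBy φ P T (fun t ω => X t ω - modelProcess ξ a N t ω) σ := by
  intro h hh t ht s hs hts
  have hbound : IsSubPhiBound φ P (fun ω => X t ω - X s ω) (σ h) :=
    ((hX t ht).sub (hX s hs) hφ).isSubPhiBound hφ (hinc h hh t ht s hs hts)
  have hmodel : ∀ n ω, modelProcess ξ a n t ω - modelProcess ξ a n s ω =
      ∑ k ∈ Finset.range (n + 1), ξ k ω * (a k t - a k s) := by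
    intro n ω
    simp only [modelProcess, mul_sub, Finset.sum_sub_distrib]
  have hmm : ∀ n t, Measurable (modelProcess ξ a n t) := fun n t =>
    Finset.measurable_fun_sum _ fun k _ => (hξ k).mul_const _
  have haem : ∀ t ∈ Set.Icc 0 T, AEMeasurable (X t) P := fun t ht =>
    (hX t ht).choose_spec.aemeasurable
  have hlim : Tendsto (fun n => eLpNorm (fun ω => (X t ω - X s ω) -
      ∑ k ∈ Finset.range (n + 1), ξ k ω * (a k t - a k s)) 2 P) atTop (𝓝 0) := by
    have hsum := (hser t ht).add (hser s hs)
    rw [add_zero] at hsum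
    refine tendsto_of_tendsto_of_tendsto_of_le_of_le tendsto_const_nhds hsum
      (fun _ => zero_le) fun n => ?_
    have he : (fun ω => (X t ω - X s ω) - ∑ k ∈ Finset.range (n + 1), ξ k ω * (a k t - a k s)) =
        (fun ω => X t ω - modelProcess ξ a n t ω) - fun ω => X s ω - modelProcess ξ a n s ω := by
      ext ω
      rw [← hmodel, Pi.sub_apply]
      ring
    simp only [he]
    exact eLpNorm_sub_le ((haem t ht).sub (hmm n t).aemeasurable).aestronglyMeasurable
      ((haem s hs).sub (hmm n s).aemeasurable).aestronglyMeasurable (by norm_num)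
  have hI := indepFun_sum_range_sub hξ hind (fun k => a k t - a k s)
    ((haem t ht).sub (haem s hs)) hlim N
  simp only [← hmodel] at hI
  refine IsSubPhiBound.tauPhi_le (IsSubPhiBound.of_add_of_indepFun hφ
    ((hXN t ht).sub (hXN s hs) hφ)
    (((hX t ht).sub (hXN t ht) hφ).sub ((hX s hs).sub (hXN s hs) hφ) hφ) ?_ ?_)
  · refine hI.congr (ae_eq_refl _) (ae_of_all _ fun ω => ?_)
    simp only [Pi.sub_apply]
    ring
  · convert hbound using 2 with ω
    ring

end IndependentSeries

/-! ### Path continuity of the model and separability of the remainder. -/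

section ModelContinuity

variable {Ω : Type*} [MeasurableSpace Ω] {P : Measure Ω}

/-- If a family of linear combinations of finitely many random variables is continuous in `L¹`,
then, outside a null set, its paths are continuous. -/
theorem ae_continuousOn_sum_of_tendsto_integral_abs {ι : Type*} [Fintype ι] {D : Set ℝ}
    {ξ : ι → Ω → ℝ} {c : ι → ℝ → ℝ}
    (hint : ∀ t ∈ D, Integrable (fun ω => ∑ k, ξ k ω * c k t) P)
    (hcont : ∀ s ∈ D, Tendsto (fun t => ∫ ω, |∑ k, ξ k ω * c k t - ∑ k, ξ k ω * c k s| ∂P)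
      (𝓝[D] s) (𝓝 0)) :
    ∀ᵐ ω ∂P, ContinuousOn (fun t => ∑ k, ξ k ω * c k t) D := by
  let comb : Ω → (ι → ℝ) →ₗ[ℝ] ℝ := fun ω =>
    { toFun := fun x => ∑ k, ξ k ω * x k
      map_add' := fun x y => by simp only [Pi.add_apply, mul_add, Finset.sum_add_distrib]
      map_smul' := fun r x => by
        simp only [Pi.smul_apply, smul_eq_mul, Finset.mul_sum, RingHom.id_apply]
        exact Finset.sum_congr rfl fun k _ => by ring }
  let W : Submodule ℝ (ι → ℝ) :=
    { carrier := {x | MemLp (fun ω => comb ω x) 1 P}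
      zero_mem' := by simp
      add_mem' := fun {x y} hx hy => by
        change MemLp (fun ω => comb ω (x + y)) 1 P
        simp only [map_add]
        exact MemLp.add hx hy
      smul_mem' := fun r x hx => by
        change MemLp (fun ω => comb ω (r • x)) 1 P
        simp only [map_smul]
        exact MemLp.const_smul hx r }
  let Ψ : W →ₗ[ℝ] Lp ℝ 1 P :=
    { toFun := fun x => MemLp.toLp (fun ω => comb ω x) x.2
      map_add' := fun x y => by
        rw [← MemLp.toLp_add]
        congr 1
        ext ω
        simp
      map_smul' := fun r x => by
        rw [RingHom.id_apply, ← MemLp.toLp_const_smul]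
        congr 1
        ext ω
        simp }
  -- A linear section of the map from coefficients to L¹. The coefficients c(t) need not be
  -- continuous, but their replacements g(Ψ c(t)) are, by finite dimensionality.
  obtain ⟨g, hg⟩ :=
    Ψ.rangeRestrict.exists_rightInverse_of_surjective (LinearMap.range_rangeRestrict Ψ)
  have hgc : Continuous g := g.continuous_of_finiteDimensional
  -- A finite generating set of the kernel provides one null set valid for all x.
  have hker : ∀ᵐ ω ∂P, ∀ x ∈ LinearMap.ker Ψ, comb ω (x : ι → ℝ) = 0 := by
    obtain ⟨s, hs⟩ := IsNoetherian.noetherian (LinearMap.ker Ψ)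
    have h0 : ∀ᵐ ω ∂P, ∀ y ∈ s, comb ω (y : ι → ℝ) = 0 := by
      rw [Finset.eventually_all]
      intro y hy
      have hy' : Ψ y = 0 := by
        rw [← LinearMap.mem_ker, ← hs]
        exact Submodule.subset_span hy
      have := MemLp.coeFn_toLp y.2
      rw [show MemLp.toLp (fun ω => comb ω y) y.2 = 0 from hy'] at this
      exact this.symm.trans (Lp.coeFn_zero ℝ 1 P)
    filter_upwards [h0] with ω hω x hx
    rw [← hs] at hx
    have hle : Submodule.span ℝ (s : Set W) ≤ LinearMap.ker (comb ω ∘ₗ W.subtype) :=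
      Submodule.span_le.2 fun y hy => hω y hy
    exact hle hx
  have hW : ∀ t ∈ D, (fun k => c k t) ∈ W := fun t ht => memLp_one_iff_integrable.2 (hint t ht)
  let w : D → W := fun t => ⟨fun k => c k t, hW t t.2⟩
  have hw : Continuous fun t => Ψ.rangeRestrict (w t) := by
    rw [continuous_induced_rng, continuous_iff_continuousAt]
    intro s
    rw [ContinuousAt, tendsto_iff_dist_tendsto_zero]
    have := (tendsto_nhdsWithin_iff_subtype s.2 _ _).1 (hcont s s.2)
    refine this.congr fun t => ?_
    change ∫ ω, |∑ k, ξ k ω * c k t - ∑ k, ξ k ω * c k s| ∂P = dist (Ψ (w t)) (Ψ (w s))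
    rw [L1.dist_eq_integral_dist]
    refine integral_congr_ae ?_
    filter_upwards [MemLp.coeFn_toLp (w t).2, MemLp.coeFn_toLp (w s).2] with ω h1 h2
    rw [Real.dist_eq]
    exact congrArg₂ (fun x y => |x - y|) h1.symm h2.symm
  filter_upwards [hker] with ω hω
  rw [continuousOn_iff_continuous_domRestrict]
  have hlin : Continuous fun x : W => comb ω x :=
    (comb ω ∘ₗ W.subtype).continuous_of_finiteDimensional
  refine (hlin.comp (hgc.comp hw)).congr fun t => ?_
  have hz := hω (w t - g (Ψ.rangeRestrict (w t))) (by
    have := LinearMap.congr_fun hg (Ψ.rangeRestrict (w t))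
    rw [LinearMap.mem_ker, map_sub, sub_eq_zero]
    exact (congrArg Subtype.val this).symm)
  rw [Submodule.coe_sub, map_sub, sub_eq_zero] at hz
  exact hz.symm

/-- Subtracting a process with continuous paths from a separable process, the remainder is
bounded by its values on a countable set. -/
theorem exists_countable_abs_sub_le_of_separable {T : ℝ} {X Y : ℝ → Ω → ℝ}
    (hX : SeparableProcess P T X)
    (hY : ∀ᵐ ω ∂P, ContinuousOn (fun t => Y t ω) (Set.Icc 0 T)) :
    ∃ S : Set ℝ, S.Countable ∧ S ⊆ Set.Icc 0 T ∧ ∀ᵐ ω ∂P, ∀ δ : ℝ,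
      (∀ s ∈ S, |X s ω - Y s ω| ≤ δ) → ∀ t ∈ Set.Icc 0 T, |X t ω - Y t ω| ≤ δ := by
  obtain ⟨S, hS, hST, hae⟩ := hX
  refine ⟨S, hS, hST, ?_⟩
  filter_upwards [hae, hY] with ω hω hc δ hδ t ht
  refine le_of_forall_pos_le_add fun ε hε => ?_
  obtain ⟨r, hr, hball⟩ := Metric.continuousOn_iff.1 hc t ht ε hε
  have := hω (Metric.ball t r) (Metric.closedBall (Y t ω) (δ + ε)) Metric.isOpen_ball
    Metric.isClosed_closedBall (fun s hs => ?_) t ⟨Metric.mem_ball_self hr, ht⟩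
  · rwa [Metric.mem_closedBall, Real.dist_eq] at this
  · rw [Metric.mem_closedBall, Real.dist_eq]
    have h1 := hδ s hs.2
    have h2 := hball s (hST hs.2) hs.1
    rw [Real.dist_eq] at h2
    have h3 := abs_add_le (X s ω - Y s ω) (Y s ω - Y t ω)
    rw [sub_add_sub_cancel] at h3
    linarith

variable {φ : ℝ → ℝ}

/-- Model increments are differences of increments of X and of the remainder, so their L¹ norms are
of order |t - s|^α. -/
theorem ae_continuousOn_modelProcess (hφ : IsOrliczNFunction φ) {T C α : ℝ} (hC : 0 < C)
    (hα : 0 < α) {X : ℝ → Ω → ℝ} {ξ : ℕ → Ω → ℝ} {a : ℕ → ℝ → ℝ} {N : ℕ}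
    (hX : ProcessSubPhi φ P T X) (hXN : ProcessSubPhi φ P T (modelProcess ξ a N))
    (hinc : IncrementsBoundedBy φ P T X (fun h => C * h ^ α))
    (hinc' : IncrementsBoundedBy φ P T (fun t ω => X t ω - modelProcess ξ a N t ω)
      (fun h => C * h ^ α)) :
    ∀ᵐ ω ∂P, ContinuousOn (fun t => modelProcess ξ a N t ω) (Set.Icc 0 T) := by
  have hle : ∀ s ∈ Set.Icc 0 T, ∀ t ∈ Set.Icc 0 T,
      ∫ ω, |(modelProcess ξ a N t ω - modelProcess ξ a N s ω)| ∂P ≤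
        4 * C * Real.exp (φ 1) * |t - s| ^ α := by
    intro s hs t ht
    rcases eq_or_ne t s with rfl | hne
    · simp only [sub_self, abs_zero, integral_zero]
      positivity
    have hpos : 0 < |t - s| := abs_pos.2 (sub_ne_zero.2 hne)
    have hσ : 0 < C * |t - s| ^ α := by positivity
    have h1 : IsSubPhiBound φ P (fun ω => X t ω - X s ω) (C * |t - s| ^ α) :=
      ((hX t ht).sub (hX s hs) hφ).isSubPhiBound hφ (hinc _ hpos t ht s hs le_rfl)
    have h2 : IsSubPhiBound φ P (fun ω => (X t ω - modelProcess ξ a N t ω) -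
        (X s ω - modelProcess ξ a N s ω)) (C * |t - s| ^ α) :=
      (((hX t ht).sub (hXN t ht) hφ).sub ((hX s hs).sub (hXN s hs) hφ) hφ).isSubPhiBound hφ
        (hinc' _ hpos t ht s hs le_rfl)
    have h3 := (h1.sub h2 hφ hσ hσ).integral_abs_le hφ (by positivity)
    refine le_trans (le_of_eq ?_) (h3.trans_eq (by ring))
    congr 1
    ext ω
    congr 1
    ring
  have hsum : ∀ t ω, modelProcess ξ a N t ω = ∑ k : Fin (N + 1), ξ k ω * a k t := fun t ω =>
    Finset.sum_range _
  simp only [hsum] at hle ⊢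
  refine ae_continuousOn_sum_of_tendsto_integral_abs (c := fun (k : Fin (N + 1)) t => a k t)
    (fun t ht => ?_) fun s hs => ?_
  · have := (hXN t ht).choose_spec.integrable
    simpa only [← hsum] using this
  · refine squeeze_zero' (Eventually.of_forall fun t => integral_nonneg fun ω => abs_nonneg _)
      (eventually_mem_nhdsWithin.mono fun t ht => hle s hs t ht) ?_
    have hcont : Continuous fun t : ℝ => 4 * C * Real.exp (φ 1) * |t - s| ^ α := by
      refine continuous_const.mul (Continuous.rpow_const (by fun_prop) fun _ => Or.inr hα.le)
    have := hcont.tendsto s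
    simp only [sub_self, abs_zero, Real.zero_rpow hα.ne', mul_zero] at this
    exact this.mono_left nhdsWithin_le_nhds

end ModelContinuity

/-! ### Estimates for the weights (1 - p) p^j and nets of an interval. -/

section GeometricWeights

variable {p : ℝ}

theorem sum_geometric_weights (p : ℝ) (m : ℕ) :
    ∑ j ∈ Finset.range m, (1 - p) * p ^ j = 1 - p ^ m := by
  rw [← Finset.mul_sum, mul_neg_geom_sum]

theorem sum_geometric_weights_mul_succ_le (hp0 : 0 < p) (hp1 : p < 1) (m : ℕ) :
    ∑ j ∈ Finset.range m, (1 - p) * p ^ j * (j + 1) ≤ 1 / (1 - p) := by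
  have hq : 0 < 1 - p := sub_pos.2 hp1
  have key : (∑ j ∈ Finset.range m, (1 - p) * p ^ j * (j + 1)) * (1 - p) =
      1 - p ^ m * (1 + m * (1 - p)) := by
    induction m with
    | zero => simp
    | succ m ih =>
      rw [Finset.sum_range_succ, add_mul, ih]
      push_cast
      ring
  rw [le_div_iff₀ hq, key]
  have : 0 ≤ p ^ m * (1 + m * (1 - p)) := by positivity
  linarith

theorem prod_one_add_pow_rpow_le (hp0 : 0 < p) (hp1 : p < 1) (m : ℕ) :
    ∏ j ∈ Finset.range m, (1 + p ^ (j + 1)) ^ ((1 - p) * p ^ j) ≤ 3 / 2 := by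
  have hq : 0 < 1 - p := sub_pos.2 hp1
  have hsum : ∑ j ∈ Finset.range m, (1 - p) * p ^ j * p ^ (j + 1) ≤ 1 / 2 * (1 - p ^ (2 * m)) := by
    induction m with
    | zero => simp
    | succ m ih =>
      rw [Finset.sum_range_succ]
      have : 0 ≤ p ^ (2 * m) * (1 - p) ^ 2 := by positivity
      have h2 : (1 - p) * p ^ m * p ^ (m + 1) = p ^ (2 * m) * (p * (1 - p)) := by ring
      have h3 : p ^ (2 * (m + 1)) = p ^ (2 * m) * p ^ 2 := by ring
      rw [h2, h3]
      nlinarith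
  -- The extra index carries the missing weight p^m and the value 1, which leaves the product
  -- unchanged.
  have hamgm := Real.geom_mean_le_arith_mean_weighted (Finset.range (m + 1))
    (fun j => if j < m then (1 - p) * p ^ j else p ^ m)
    (fun j => if j < m then 1 + p ^ (j + 1) else 1)
    (fun j _ => by split_ifs <;> positivity)
    (by
      rw [Finset.sum_range_succ, Finset.sum_congr rfl fun j hj => if_pos (Finset.mem_range.1 hj),
        sum_geometric_weights]
      simp)
    (fun j _ => by split_ifs <;> positivity)
  rw [Finset.prod_range_succ, Finset.sum_range_succ] at hamgm
  simp only [lt_irrefl, if_false, Real.one_rpow, mul_one] at hamgm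
  rw [Finset.prod_congr rfl fun j hj => by rw [if_pos (Finset.mem_range.1 hj),
      if_pos (Finset.mem_range.1 hj)],
    Finset.sum_congr rfl fun j hj => by rw [if_pos (Finset.mem_range.1 hj),
      if_pos (Finset.mem_range.1 hj), mul_add, mul_one],
    Finset.sum_add_distrib, sum_geometric_weights] at hamgm
  have : 0 ≤ p ^ (2 * m) := by positivity
  linarith

/-- After taking logarithms this is p log(1/p) ≤ 1 - p. -/
theorem inv_rpow_one_div_one_sub_le (hp0 : 0 < p) (hp1 : p < 1) :
    p⁻¹ ^ (1 / (1 - p)) ≤ Real.exp 1 / p := by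
  have hq : 0 < 1 - p := sub_pos.2 hp1
  have hlog := Real.log_le_sub_one_of_pos (inv_pos.2 hp0)
  rw [Real.rpow_def_of_pos (inv_pos.2 hp0), div_eq_mul_inv (Real.exp 1),
    ← Real.exp_log (inv_pos.2 hp0), ← Real.exp_add, Real.exp_log (inv_pos.2 hp0)]
  refine Real.exp_le_exp.2 ?_
  rw [mul_one_div, div_le_iff₀ hq]
  have : p * Real.log p⁻¹ ≤ p * (p⁻¹ - 1) := by gcongr
  rw [mul_sub, mul_inv_cancel₀ hp0.ne'] at this
  linarith

theorem prod_inv_rpow_rpow_le {α : ℝ} (hp0 : 0 < p) (hp1 : p < 1) (hα : 0 < α) (m : ℕ) :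
    ∏ j ∈ Finset.range m, (p⁻¹ ^ ((j + 1 : ℝ) / α)) ^ ((1 - p) * p ^ j) ≤
      (Real.exp 1 / p) ^ (1 / α) := by
  have hi : 0 < p⁻¹ := inv_pos.2 hp0
  have h1 : 1 ≤ p⁻¹ := (one_le_inv₀ hp0).2 hp1.le
  calc ∏ j ∈ Finset.range m, (p⁻¹ ^ ((j + 1 : ℝ) / α)) ^ ((1 - p) * p ^ j)
      = p⁻¹ ^ ((∑ j ∈ Finset.range m, (1 - p) * p ^ j * (j + 1)) * (1 / α)) := by
        rw [Finset.sum_mul, Real.rpow_sum_of_pos hi]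
        refine Finset.prod_congr rfl fun j _ => ?_
        rw [← Real.rpow_mul hi.le]
        congr 1
        ring
    _ ≤ p⁻¹ ^ (1 / (1 - p) * (1 / α)) := by
        refine Real.rpow_le_rpow_of_exponent_le h1 ?_
        gcongr
        exact sum_geometric_weights_mul_succ_le hp0 hp1 m
    _ ≤ (Real.exp 1 / p) ^ (1 / α) := by
        rw [Real.rpow_mul hi.le]
        gcongr
        exact inv_rpow_one_div_one_sub_le hp0 hp1

end GeometricWeights

/-- The net consists of the midpoints of ⌈T/(2r)⌉ equal subintervals. -/
theorem exists_finset_net {T r : ℝ} (hT : 0 < T) (hr : 0 < r) :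
    ∃ V : Finset ℝ, (∀ x ∈ V, x ∈ Set.Icc 0 T) ∧ (V.card : ℝ) ≤ 1 + T / (2 * r) ∧
      ∀ t ∈ Set.Icc 0 T, ∃ x ∈ V, |t - x| ≤ r := by
  set n := ⌈T / (2 * r)⌉₊ with hn
  have hn0 : 0 < n := Nat.ceil_pos.2 (by positivity)
  have hn0' : (0 : ℝ) < n := Nat.cast_pos.2 hn0
  have hle : T / (2 * r) ≤ n := Nat.le_ceil _
  rw [div_le_iff₀ (by positivity)] at hle
  refine ⟨(Finset.range n).image fun i : ℕ => T * (2 * i + 1) / (2 * n), ?_, ?_, ?_⟩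
  · intro x hx
    obtain ⟨i, hi, rfl⟩ := Finset.mem_image.1 hx
    have hi' : (i : ℝ) + 1 ≤ n := by exact_mod_cast Finset.mem_range.1 hi
    refine ⟨by positivity, ?_⟩
    rw [div_le_iff₀ (by positivity)]
    gcongr
    linarith
  · calc (((Finset.range n).image fun i : ℕ => T * (2 * i + 1) / (2 * n)).card : ℝ) ≤ n := by
          exact_mod_cast Finset.card_image_le.trans_eq (Finset.card_range n)
      _ ≤ 1 + T / (2 * r) := by
          rw [add_comm]
          exact (Nat.ceil_lt_add_one (by positivity)).le
  · intro t ht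
    have hex : ∃ i < n, (i : ℝ) * T ≤ t * n ∧ t * n ≤ (i + 1) * T := by
      have hnn : 0 ≤ t * n / T := div_nonneg (mul_nonneg ht.1 hn0'.le) hT.le
      rcases lt_or_ge ⌊t * n / T⌋₊ n with h | h
      · refine ⟨_, h, (le_div_iff₀ hT).1 (Nat.floor_le hnn), ?_⟩
        exact (div_le_iff₀ hT).1 (Nat.lt_floor_add_one _).le
      -- The right endpoint t = T belongs to the last subinterval.
      · refine ⟨n - 1, Nat.sub_lt hn0 one_pos, ?_, ?_⟩
        · have h1 : (n : ℝ) ≤ t * n / T := (Nat.le_floor_iff hnn).1 h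
          rw [le_div_iff₀ hT] at h1
          rw [Nat.cast_sub (show 1 ≤ n from hn0)]
          push_cast
          nlinarith
        · rw [Nat.cast_sub (show 1 ≤ n from hn0)]
          push_cast
          nlinarith [ht.2]
    obtain ⟨i, hi, h1, h2⟩ := hex
    refine ⟨_, Finset.mem_image.2 ⟨i, Finset.mem_range.2 hi, rfl⟩, ?_⟩
    have he : t - T * (2 * i + 1) / (2 * n) = (2 * (t * n) - T * (2 * i + 1)) / (2 * n) := by
      field_simp
    rw [he, abs_div, abs_of_pos (show (0 : ℝ) < 2 * n by positivity), div_le_iff₀ (by positivity),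
      abs_le]
    constructor <;> nlinarith

/-! ### Chaining with Hölder weights. -/

section Chaining

variable {Ω : Type*} [MeasurableSpace Ω] {P : Measure Ω} {φ : ℝ → ℝ}

theorem IsSubPhiBound.lintegral_exp_le {η : Ω → ℝ} {b : ℝ} (h : IsSubPhiBound φ P η b) (l : ℝ) :
    ∫⁻ ω, ENNReal.ofReal (Real.exp (l * η ω)) ∂P ≤ ENNReal.ofReal (Real.exp (φ (b * l))) := by
  rw [← ofReal_integral_eq_lintegral_ofReal (h.2 l).1 (ae_of_all _ fun ω => (Real.exp_pos _).le)]
  exact ENNReal.ofReal_le_ofReal (h.2 l).2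

/-- Exponential tail bound for the maximum of a process over the last of the levels
`V 0, …, V m`, each of which projects to the preceding one. -/
theorem measure_exists_lt_le_prod_of_chain {m : ℕ} {V : ℕ → Finset ℝ} {π : ℕ → ℝ → ℝ}
    (hπ : ∀ j < m, ∀ x ∈ V (j + 1), π j x ∈ V j) {Y : ℝ → Ω → ℝ} {q τ : ℕ → ℝ}
    (hq : ∀ j ≤ m, 0 < q j) (hqsum : ∑ j ∈ Finset.range (m + 1), q j = 1)
    (hfirst : ∀ x ∈ V 0, IsSubPhiBound φ P (Y x) (τ 0))
    (hstep : ∀ j < m, ∀ x ∈ V (j + 1),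
      IsSubPhiBound φ P (fun ω => Y x ω - Y (π j x) ω) (τ (j + 1)))
    {l : ℝ} (hl : 0 < l) (δ : ℝ) :
    P {ω | ∃ x ∈ V m, δ < Y x ω} ≤ ENNReal.ofReal (Real.exp (-(l * δ)) *
      ∏ j ∈ Finset.range (m + 1), ((V j).card * Real.exp (φ (τ j * (l / q j)))) ^ q j) := by
  -- The links of the chain: Y itself at level 0, then increments, which telescope to Y. At each
  -- level the maximum of the exponentials is replaced by the sum `g`.
  set Z : ℕ → ℝ → Ω → ℝ := fun j x ω => Nat.casesOn j (Y x ω) fun i => Y x ω - Y (π i x) ω with hZ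
  have hZb : ∀ j ≤ m, ∀ x ∈ V j, IsSubPhiBound φ P (Z j x) (τ j) := by
    rintro (_ | j) hj x hx
    · exact hfirst x hx
    · exact hstep j hj x hx
  have hZm : ∀ j ≤ m, ∀ x ∈ V j,
      AEMeasurable (fun ω => ENNReal.ofReal (Real.exp (l / q j * Z j x ω))) P := fun j hj x hx =>
    (Real.measurable_exp.comp_aemeasurable
      ((hZb j hj x hx).aemeasurable.const_mul _)).ennreal_ofReal
  set g : ℕ → Ω → ENNReal := fun j ω =>
    ∑ x ∈ V j, ENNReal.ofReal (Real.exp (l / q j * Z j x ω)) with hg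
  have hgm : ∀ j ≤ m, AEMeasurable (g j) P := fun j hj =>
    Finset.aemeasurable_fun_sum _ fun x hx => hZm j hj x hx
  have hterm : ∀ j ≤ m, ∀ x ∈ V j, ∀ ω,
      ENNReal.ofReal (Real.exp (l * Z j x ω)) ≤ g j ω ^ q j := by
    intro j hj x hx ω
    have h1 : ENNReal.ofReal (Real.exp (l / q j * Z j x ω)) ≤ g j ω :=
      Finset.single_le_sum (f := fun x => ENNReal.ofReal (Real.exp (l / q j * Z j x ω)))
        (fun _ _ => zero_le) hx
    calc ENNReal.ofReal (Real.exp (l * Z j x ω))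
        = ENNReal.ofReal (Real.exp (l / q j * Z j x ω)) ^ q j := by
          rw [ENNReal.ofReal_rpow_of_pos (Real.exp_pos _), ← Real.exp_mul]
          congr 2
          have := (hq j hj).ne'
          field_simp
      _ ≤ g j ω ^ q j := ENNReal.rpow_le_rpow h1 (hq j hj).le
  have hchain : ∀ j ≤ m, ∀ x ∈ V j, ∀ ω, ENNReal.ofReal (Real.exp (l * Y x ω)) ≤
      ∏ i ∈ Finset.range (j + 1), g i ω ^ q i := by
    intro j
    induction j with
    | zero =>
      intro hj x hx ω
      rw [Finset.prod_range_one]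
      exact hterm 0 hj x hx ω
    | succ j ih =>
      intro hj x hx ω
      rw [Finset.prod_range_succ]
      have h1 := ih (by omega) (π j x) (hπ j hj x hx) ω
      have h2 := hterm (j + 1) hj x hx ω
      refine le_trans (le_of_eq ?_) (mul_le_mul' h1 h2)
      rw [← ENNReal.ofReal_mul (Real.exp_pos _).le, ← Real.exp_add]
      congr 2
      simp only [hZ]
      ring
  have hmem : ∀ j ∈ Finset.range (m + 1), j ≤ m := fun j hj =>
    Nat.lt_succ_iff.1 (Finset.mem_range.1 hj)
  have hprodm : AEMeasurable (fun ω => ∏ j ∈ Finset.range (m + 1), g j ω ^ q j) P :=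
    Finset.aemeasurable_fun_prod _ fun j hj => (hgm j (hmem j hj)).pow_const _
  have hpoint : ∀ ω ∈ {ω | ∃ x ∈ V m, δ < Y x ω}, 1 ≤ ENNReal.ofReal (Real.exp (-(l * δ))) *
      ∏ j ∈ Finset.range (m + 1), g j ω ^ q j := by
    rintro ω ⟨x, hx, hxδ⟩
    refine le_trans ?_ (mul_le_mul' le_rfl (hchain m le_rfl x hx ω))
    rw [← ENNReal.ofReal_mul (Real.exp_pos _).le, ← Real.exp_add, ENNReal.one_le_ofReal,
      Real.one_le_exp_iff]
    nlinarith
  refine (meas_le_lintegral₀ (hprodm.const_mul _) hpoint).trans ?_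
  rw [lintegral_const_mul'' _ hprodm, ENNReal.ofReal_mul (Real.exp_pos _).le]
  refine mul_le_mul' le_rfl ?_
  refine (ENNReal.lintegral_prod_norm_pow_le _ (fun j hj => hgm j (hmem j hj)) hqsum
    fun j hj => (hq j (hmem j hj)).le).trans ?_
  rw [ENNReal.ofReal_prod_of_nonneg fun j _ => by positivity]
  refine Finset.prod_le_prod' fun j hj => ?_
  rw [← ENNReal.ofReal_rpow_of_nonneg (by positivity) (hq j (hmem j hj)).le]
  refine ENNReal.rpow_le_rpow ?_ (hq j (hmem j hj)).le
  simp only [hg]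
  rw [lintegral_finsetSum' _ fun x hx => hZm j (hmem j hj) x hx]
  refine (Finset.sum_le_sum fun x hx =>
    (hZb j (hmem j hj) x hx).lintegral_exp_le (l / q j)).trans_eq ?_
  rw [Finset.sum_const, nsmul_eq_mul, ENNReal.ofReal_mul (Nat.cast_nonneg _),
    ENNReal.ofReal_natCast]

end Chaining

/-! ### The entropy bound on finite and countable sets. -/

section EntropyBound

variable {Ω : Type*} [MeasurableSpace Ω] {P : Measure Ω} {φ : ℝ → ℝ}

set_option maxHeartbeats 1000000 in
theorem measure_exists_finset_lt_le_of_pow (hφ : IsOrliczNFunction φ) {T C α γ p l : ℝ}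
    (hT : 0 < T) (hC : 0 < C) (hα : α ∈ Set.Ioo (0 : ℝ) 1) (hp0 : 0 < p) (hp1 : p < 1)
    (hl : 0 < l) {Y : ℝ → Ω → ℝ} (hY : ∀ t ∈ Set.Icc 0 T, IsSubPhiBound φ P (Y t) γ)
    (hinc : ∀ h, 0 < h → ∀ t ∈ Set.Icc 0 T, ∀ s ∈ Set.Icc 0 T, |t - s| ≤ h →
      IsSubPhiBound φ P (fun ω => Y t ω - Y s ω) (C * h ^ α))
    (F : Finset ℝ) (hF : ∀ t ∈ F, t ∈ Set.Icc 0 T) (δ : ℝ) (m : ℕ) :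
    P {ω | ∃ t ∈ F, δ < Y t ω} ≤ ENNReal.ofReal
      (Real.exp (-(l * δ) + ((1 - p) * φ (l * γ / (1 - p)) +
        p * φ (l * (C * (T / 2) ^ α) / (1 - p)))) *
      (3 / 2 * (Real.exp 1 / p) ^ (1 / α) * (F.card + 1 : ℝ) ^ (p ^ (m + 1)))) := by
  have hα0 := hα.1
  have h1p : 0 < 1 - p := sub_pos.2 hp1
  set β := C * (T / 2) ^ α with hβ
  have hβ0 : 0 < β := by positivity
  set r : ℕ → ℝ := fun j => T / 2 * (p ^ j) ^ (1 / α) with hr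
  have hr0 : ∀ j, 0 < r j := fun j => by simp only [hr]; positivity
  have hrα : ∀ j, C * r j ^ α = β * p ^ j := by
    intro j
    simp only [hr]
    rw [Real.mul_rpow (by positivity) (by positivity), ← Real.rpow_mul (by positivity),
      one_div_mul_cancel hα0.ne', Real.rpow_one, hβ]
    ring
  -- The index is shifted: net j has radius r (j + 1), so a link from level j + 1 down to level j
  -- has standard β p^(j+1).
  choose net hnetT hnetcard hnet using fun j => exists_finset_net hT (hr0 (j + 1))
  have hproj : ∀ j t, ∃ x, t ∈ Set.Icc 0 T → x ∈ net j ∧ |t - x| ≤ r (j + 1) := by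
    intro j t
    by_cases ht : t ∈ Set.Icc 0 T
    · obtain ⟨x, hx⟩ := hnet j t ht
      exact ⟨x, fun _ => hx⟩
    · exact ⟨0, fun h => absurd h ht⟩
  choose π hπ using hproj
  -- The given finite set is the last level. Its weight p^(m+1) completes the sum of weights to 1
  -- and tends to 0 with m, so the size of F disappears in the limit.
  set V : ℕ → Finset ℝ := fun j => if j < m + 1 then net j else F with hV
  set q : ℕ → ℝ := fun j => if j < m + 1 then (1 - p) * p ^ j else p ^ j with hq
  set τ : ℕ → ℝ := fun j => if j = 0 then γ else β * p ^ j with hτ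
  have hVT : ∀ j, ∀ x ∈ V j, x ∈ Set.Icc 0 T := by
    intro j x hx
    simp only [hV] at hx
    split_ifs at hx
    exacts [hnetT j x hx, hF x hx]
  have hVlast : V (m + 1) = F := if_neg (lt_irrefl _)
  have hqlast : q (m + 1) = p ^ (m + 1) := if_neg (lt_irrefl _)
  have hqlt : ∀ j ∈ Finset.range (m + 1), q j = (1 - p) * p ^ j := fun j hj =>
    if_pos (Finset.mem_range.1 hj)
  have hVlt : ∀ j ∈ Finset.range (m + 1), V j = net j := fun j hj =>
    if_pos (Finset.mem_range.1 hj)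
  have hq0 : ∀ j, 0 < q j := fun j => by simp only [hq]; split_ifs <;> positivity
  have hqsum : ∑ j ∈ Finset.range (m + 1 + 1), q j = 1 := by
    rw [Finset.sum_range_succ, Finset.sum_congr rfl hqlt, sum_geometric_weights, hqlast]
    ring
  have hchain := measure_exists_lt_le_prod_of_chain (P := P) (φ := φ) (m := m + 1) (V := V)
    (π := π) (Y := Y) (q := q) (τ := τ)
    (fun j hj x hx => by
      rw [hVlt j (Finset.mem_range.2 hj)]
      exact (hπ j x (hVT _ x hx)).1)
    (fun j _ => hq0 j) hqsum (fun x hx => hY x (hVT 0 x hx))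
    (fun j hj x hx => by
      have h := hπ j x (hVT _ x hx)
      have := hinc _ (hr0 (j + 1)) x (hVT _ x hx) _ (hnetT j _ h.1) h.2
      rwa [hrα] at this)
    hl δ
  rw [hVlast] at hchain
  refine hchain.trans (ENNReal.ofReal_le_ofReal ?_)
  rw [Real.exp_add, mul_assoc]
  refine mul_le_mul_of_nonneg_left ?_ (Real.exp_pos _).le
  set M : ℝ := φ (l * β / (1 - p)) with hM
  set E : ℕ → ℝ := fun j => if j = 0 then φ (l * γ / (1 - p)) else M with hE
  have hφE : ∀ j, φ (τ j * (l / q j)) ≤ E j := by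
    intro j
    rcases Nat.eq_zero_or_pos j with rfl | hj
    · simp only [hτ, hE, hq, if_true, Nat.succ_pos, pow_zero, mul_one]
      rw [mul_comm l γ, mul_div_assoc]
    · simp only [hτ, hE, hq, if_neg hj.ne']
      have hpj : 0 < p ^ j := by positivity
      split_ifs
      · refine le_of_eq ?_
        rw [hM]
        congr 1
        field_simp
      · refine hφ.monotoneOn ?_ ?_ ?_
        · rw [Set.mem_Ici]; positivity
        · rw [Set.mem_Ici]; positivity
        · rw [show β * p ^ j * (l / p ^ j) = l * β by field_simp, le_div_iff₀ h1p]
          have : 0 < l * β := by positivity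
          nlinarith
  have hEsum : ∑ j ∈ Finset.range (m + 1 + 1), q j * E j =
      (1 - p) * φ (l * γ / (1 - p)) + p * M := by
    have h1 : q 0 = 1 - p := by simp [hq]
    rw [Finset.sum_range_succ'] at hqsum ⊢
    have h2 : ∑ k ∈ Finset.range (m + 1), q (k + 1) * E (k + 1) =
        (∑ k ∈ Finset.range (m + 1), q (k + 1)) * M := by
      rw [Finset.sum_mul]
      exact Finset.sum_congr rfl fun k _ => by simp [hE]
    rw [h2, h1, show ∑ k ∈ Finset.range (m + 1), q (k + 1) = p by linarith]
    simp only [hE, if_true]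
    ring
  have hcard : ∀ j ∈ Finset.range (m + 1),
      ((V j).card : ℝ) ^ q j ≤ (1 + p ^ (j + 1)) ^ ((1 - p) * p ^ j) *
        (p⁻¹ ^ ((j + 1 : ℝ) / α)) ^ ((1 - p) * p ^ j) := by
    intro j hj
    rw [hVlt j hj, hqlt j hj, ← Real.mul_rpow (by positivity) (by positivity)]
    refine Real.rpow_le_rpow (Nat.cast_nonneg _) ((hnetcard j).trans ?_) (by positivity)
    have hpj : 0 < p ^ (j + 1) := by positivity
    have hpj1 : p ^ (j + 1) ≤ 1 := pow_le_one₀ hp0.le hp1.le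
    have e1 : T / (2 * r (j + 1)) = p⁻¹ ^ ((j + 1 : ℝ) / α) := by
      simp only [hr]
      rw [← Real.rpow_natCast, ← Real.rpow_mul hp0.le, Real.inv_rpow hp0.le]
      push_cast
      rw [mul_one_div]
      field_simp
    -- Since α < 1, the summand 1 in the net size is at most p^(j+1) times the main term; the
    -- resulting factors 1 + p^(j+1) multiply to at most 3/2.
    have e2 : 1 ≤ p ^ (j + 1) * p⁻¹ ^ ((j + 1 : ℝ) / α) := by
      have h3 : p⁻¹ ^ ((j + 1 : ℝ)) ≤ p⁻¹ ^ ((j + 1 : ℝ) / α) := by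
        refine Real.rpow_le_rpow_of_exponent_le ((one_le_inv₀ hp0).2 hp1.le) ?_
        rw [le_div_iff₀ hα0]
        exact mul_le_of_le_one_right (by positivity) hα.2.le
      have h4 : p⁻¹ ^ ((j + 1 : ℝ)) = (p ^ (j + 1))⁻¹ := by
        rw [Real.inv_rpow hp0.le, ← Real.rpow_natCast]
        push_cast
        rfl
      rw [h4] at h3
      calc (1 : ℝ) = p ^ (j + 1) * (p ^ (j + 1))⁻¹ := (mul_inv_cancel₀ hpj.ne').symm
        _ ≤ _ := by gcongr
    rw [e1]
    linarith
  calc ∏ j ∈ Finset.range (m + 1 + 1), ((V j).card * Real.exp (φ (τ j * (l / q j)))) ^ q j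
      ≤ ∏ j ∈ Finset.range (m + 1 + 1), ((V j).card : ℝ) ^ q j * Real.exp (q j * E j) := by
        refine Finset.prod_le_prod (fun j _ => by positivity) fun j _ => ?_
        rw [Real.mul_rpow (Nat.cast_nonneg _) (Real.exp_pos _).le, ← Real.exp_mul, mul_comm _ (q j)]
        have := (hq0 j).le
        gcongr
        exact hφE j
    _ = Real.exp ((1 - p) * φ (l * γ / (1 - p)) + p * M) *
        ∏ j ∈ Finset.range (m + 1 + 1), ((V j).card : ℝ) ^ q j := by
        rw [Finset.prod_mul_distrib, ← Real.exp_sum, hEsum, mul_comm]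
    _ ≤ _ := by
        refine mul_le_mul_of_nonneg_left ?_ (Real.exp_pos _).le
        rw [Finset.prod_range_succ, hVlast, hqlast]
        refine mul_le_mul ?_ ?_ (by positivity) (by positivity)
        · refine (Finset.prod_le_prod (fun j _ => by positivity) hcard).trans ?_
          rw [Finset.prod_mul_distrib]
          exact mul_le_mul (prod_one_add_pow_rpow_le hp0 hp1 _)
            (prod_inv_rpow_rpow_le hp0 hp1 hα0 _)
            (Finset.prod_nonneg fun j _ => by positivity) (by norm_num)
        · exact Real.rpow_le_rpow (Nat.cast_nonneg _) (lt_add_one _).le (pow_nonneg hp0.le _)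

theorem measure_exists_lt_le (hφ : IsOrliczNFunction φ) {T C α γ p l : ℝ}
    (hT : 0 < T) (hC : 0 < C) (hα : α ∈ Set.Ioo (0 : ℝ) 1) (hp0 : 0 < p) (hp1 : p < 1)
    (hl : 0 < l) {Y : ℝ → Ω → ℝ} (hY : ∀ t ∈ Set.Icc 0 T, IsSubPhiBound φ P (Y t) γ)
    (hinc : ∀ h, 0 < h → ∀ t ∈ Set.Icc 0 T, ∀ s ∈ Set.Icc 0 T, |t - s| ≤ h →
      IsSubPhiBound φ P (fun ω => Y t ω - Y s ω) (C * h ^ α))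
    {S : Set ℝ} (hS : S.Countable) (hST : S ⊆ Set.Icc 0 T) (δ : ℝ) :
    P {ω | ∃ t ∈ S, δ < Y t ω} ≤ ENNReal.ofReal
      (Real.exp (-(l * δ) + ((1 - p) * φ (l * γ / (1 - p)) +
        p * φ (l * (C * (T / 2) ^ α) / (1 - p)))) *
      (3 / 2 * (Real.exp 1 / p) ^ (1 / α))) := by
  set D := Real.exp (-(l * δ) + ((1 - p) * φ (l * γ / (1 - p)) +
        p * φ (l * (C * (T / 2) ^ α) / (1 - p)))) with hD
  set K := 3 / 2 * (Real.exp 1 / p) ^ (1 / α) with hK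
  have hfin : ∀ F : Finset ℝ, (∀ t ∈ F, t ∈ S) →
      P {ω | ∃ t ∈ F, δ < Y t ω} ≤ ENNReal.ofReal (D * K) := by
    intro F hF
    -- The added 1 keeps the base nonzero for empty F, so the power is continuous at exponent 0.
    have hlim : Tendsto (fun m : ℕ => ENNReal.ofReal (D * (K * (F.card + 1 : ℝ) ^ (p ^ (m + 1)))))
        atTop (𝓝 (ENNReal.ofReal (D * (K * (F.card + 1 : ℝ) ^ (0 : ℝ))))) := by
      refine ENNReal.tendsto_ofReal (Tendsto.const_mul _ (Tendsto.const_mul _ ?_))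
      refine Tendsto.rpow tendsto_const_nhds ?_ (Or.inl (by positivity))
      exact (tendsto_pow_atTop_nhds_zero_of_lt_one hp0.le hp1).comp (tendsto_add_atTop_nat 1)
    rw [Real.rpow_zero, mul_one] at hlim
    exact ge_of_tendsto hlim (Eventually.of_forall fun m =>
      measure_exists_finset_lt_le_of_pow hφ hT hC hα hp0 hp1 hl hY hinc F
        (fun t ht => hST (hF t ht)) δ m)
  have := hS.to_subtype
  have hunion : {ω | ∃ t ∈ S, δ < Y t ω} =
      ⋃ F : Finset S, {ω | ∃ t ∈ F, δ < Y (t : ℝ) ω} := by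
    ext ω
    simp only [Set.mem_ofPred_eq, Set.mem_iUnion]
    constructor
    · rintro ⟨t, ht, h⟩
      exact ⟨{⟨t, ht⟩}, ⟨t, ht⟩, Finset.mem_singleton_self _, h⟩
    · rintro ⟨F, t, -, h⟩
      exact ⟨t, t.2, h⟩
  rw [hunion, Directed.measure_iUnion]
  · refine iSup_le fun F => ?_
    have := hfin (F.map (Function.Embedding.subtype _)) (by
      intro t ht
      obtain ⟨x, -, rfl⟩ := Finset.mem_map.1 ht
      exact x.2)
    simpa using this
  · refine Monotone.directed_le fun F G hFG ω => ?_
    rintro ⟨t, ht, h⟩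
    exact ⟨t, hFG ht, h⟩

end EntropyBound

/-! ### Choice of p and l, and comparison of φ with the pure power. -/

section Optimization

theorem IsClassI.apply_one {φ : ℝ → ℝ} {ζ : ℝ} (h : IsClassI φ ζ) : φ 1 = 1 / ζ := by
  have h1 : Tendsto φ (𝓝[>] 1) (𝓝 (φ 1)) :=
    (h.nFunction.continuous.tendsto 1).mono_left nhdsWithin_le_nhds
  have hc : Continuous fun t : ℝ => t ^ ζ / ζ :=
    (Real.continuous_rpow_const (by linarith [h.two_le])).div_const ζ
  have h2 : Tendsto φ (𝓝[>] 1) (𝓝 ((1 : ℝ) ^ ζ / ζ)) := by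
    refine ((hc.tendsto 1).mono_left nhdsWithin_le_nhds).congr' ?_
    filter_upwards [self_mem_nhdsWithin] with t ht
    exact (h.eq_rpow t ht).symm
  rw [tendsto_nhds_unique h1 h2, Real.one_rpow]

/-- A function of class `C_I` exceeds the power `s ^ ζ / ζ` by at most `1 / 4`. -/
theorem IsClassI.le_rpow_div_add {φ : ℝ → ℝ} {ζ : ℝ} (h : IsClassI φ ζ) {s : ℝ} (hs : 0 ≤ s) :
    φ s ≤ s ^ ζ / ζ + 1 / 4 := by
  have hζ := h.two_le
  have hζ0 : 0 < ζ := by linarith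
  rcases lt_or_ge 1 s with h1 | h1
  · rw [h.eq_rpow s h1]
    linarith
  have hc := h.nFunction.convex.2 (Set.mem_univ 1) (Set.mem_univ 0) hs (sub_nonneg.2 h1) (by ring)
  simp only [smul_eq_mul, mul_zero, mul_one, add_zero, h.nFunction.map_zero, h.apply_one] at hc
  -- Convexity gave φ(s) ≤ s/ζ on [0, 1]. Bernoulli gives ζ(s - s^ζ) ≤ ζ - 1 ≤ ζ²/4, which yields
  -- the constant 1/4.
  have hb := one_add_mul_self_le_rpow_one_add (s := s - 1) (by linarith) (p := ζ) (by linarith)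
  rw [add_sub_cancel] at hb
  have hu : 0 ≤ s ^ ζ := Real.rpow_nonneg hs ζ
  have hkey : s - s ^ ζ ≤ ζ / 4 := by
    have : ζ * (s - s ^ ζ) ≤ ζ * (ζ / 4) := by
      nlinarith [sq_nonneg (ζ - 2), mul_nonneg (show 0 ≤ ζ - 1 by linarith) hu]
    exact le_of_mul_le_mul_left this hζ0
  calc φ s ≤ s / ζ := by linarith [mul_one_div s ζ]
    _ ≤ (s ^ ζ + ζ / 4) / ζ := by gcongr; linarith
    _ = s ^ ζ / ζ + 1 / 4 := by field_simp

/-- The value of the exponent `-l x + (1 - p) (l γ / (1 - p)) ^ ζ / ζ + p (l β / (1 - p)) ^ ζ / ζ`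
at `p = γ / x` and the optimal `l`. -/
theorem exists_exponent_eq {ζ β γ x : ℝ} (hζ : 2 ≤ ζ) (hβ : 0 < β) (hγ : 0 < γ) (hx : γ < x) :
    ∃ l, 0 < l ∧ -(l * x) + ((1 - γ / x) * ((l * γ / (1 - γ / x)) ^ ζ / ζ) +
        γ / x * ((l * β / (1 - γ / x)) ^ ζ / ζ)) =
      -((ζ - 1) * x ^ (1 / (ζ - 1)) * (x - γ) ^ (ζ / (ζ - 1)) /
        (ζ * (γ ^ ζ * (x - γ) + β ^ ζ * γ) ^ (1 / (ζ - 1)))) := by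
  have hx0 : 0 < x := hγ.trans hx
  have hd : 0 < x - γ := sub_pos.2 hx
  have hζ0 : 0 < ζ := by linarith
  have hζ1 : 0 < ζ - 1 := by linarith
  set G := γ ^ ζ * (x - γ) + β ^ ζ * γ with hG
  have hG0 : 0 < G := by positivity
  -- E is the value of l x at the critical point of the exponent in l; the minimum is -(1 - 1/ζ) E.
  set E := x ^ (1 / (ζ - 1)) * (x - γ) ^ (ζ / (ζ - 1)) / G ^ (1 / (ζ - 1)) with hE
  have hE0 : 0 < E := by positivity
  have hEpow : E ^ (ζ - 1) = x * (x - γ) ^ ζ / G := by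
    rw [hE, Real.div_rpow (by positivity) (by positivity),
      Real.mul_rpow (by positivity) (by positivity), ← Real.rpow_mul hx0.le,
      ← Real.rpow_mul hd.le, ← Real.rpow_mul hG0.le, one_div_mul_cancel hζ1.ne',
      div_mul_cancel₀ ζ hζ1.ne', Real.rpow_one, Real.rpow_one]
  have hEζ : E ^ ζ = E * (x * (x - γ) ^ ζ / G) := by
    rw [← hEpow, mul_comm, ← Real.rpow_add_one hE0.ne', sub_add_cancel]
  refine ⟨E / x, by positivity, ?_⟩
  have hscale : ∀ b, 0 < b → (E / x * b / (1 - γ / x)) ^ ζ = E ^ ζ * b ^ ζ / (x - γ) ^ ζ := by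
    intro b hb
    rw [← Real.mul_rpow hE0.le hb.le, ← Real.div_rpow (by positivity) hd.le]
    congr 1
    rw [one_sub_div hx0.ne']
    field_simp
  have hdζ : 0 < (x - γ) ^ ζ := by positivity
  have hsum : (1 - γ / x) * (E ^ ζ * γ ^ ζ / (x - γ) ^ ζ / ζ) +
      γ / x * (E ^ ζ * β ^ ζ / (x - γ) ^ ζ / ζ) = E ^ ζ * G / (x * (x - γ) ^ ζ * ζ) := by
    rw [hG]
    field_simp
  rw [hscale γ hγ, hscale β hβ, hsum, hEζ, div_mul_cancel₀ E hx0.ne',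
    show (ζ - 1) * x ^ (1 / (ζ - 1)) * (x - γ) ^ (ζ / (ζ - 1)) / (ζ * G ^ (1 / (ζ - 1))) =
      (ζ - 1) / ζ * E by rw [hE]; field_simp]
  field_simp
  ring

/-- The quadratic whose larger root is the threshold takes the value -β^ζ < 0 at γ. Equivalently,
its discriminant is γ²(v-1)² + 4vβ^ζ. -/
theorem le_accuracyThreshold {ζ β γ : ℝ} (hβ : 0 < β) (hγ : 0 < γ) :
    γ ≤ accuracyThreshold ζ β γ := by
  have hmin : 0 < min β γ := lt_min hβ hγ
  rw [accuracyThreshold]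
  set v := min β γ ^ (ζ - 1)
  have hv : 0 < v := by positivity
  have hβζ : 0 < β ^ ζ := by positivity
  rw [le_div_iff₀ (by positivity)]
  have hsq : (γ * (v - 1)) ^ 2 ≤ γ ^ 2 * (v + 1) ^ 2 + 4 * v * (β ^ ζ - γ ^ 2) := by
    have : 0 < v * β ^ ζ := by positivity
    nlinarith
  linarith [(le_abs_self _).trans (Real.abs_le_sqrt hsq)]

theorem exp_one_quarter_mul_le : Real.exp (1 / 4) * (3 / 2) ≤ 2 := by
  have h4 : Real.exp (1 / 4) ^ 4 ≤ (4 / 3 : ℝ) ^ 4 := by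
    rw [← Real.exp_nat_mul]
    norm_num
    linarith [Real.exp_one_lt_d9]
  linarith [le_of_pow_le_pow_left₀ (by norm_num) (by norm_num) h4]

theorem exists_exponential_bound_le_deviationBound {φ : ℝ → ℝ} {ζ α β γ x : ℝ}
    (hφ : IsClassI φ ζ) (hα : 0 < α) (hβ : 0 < β) (hγ : 0 < γ) (hx : γ < x) :
    ∃ l, 0 < l ∧ Real.exp (-(l * x) + ((1 - γ / x) * φ (l * γ / (1 - γ / x)) +
        γ / x * φ (l * β / (1 - γ / x)))) * (3 / 2 * (Real.exp 1 / (γ / x)) ^ (1 / α)) ≤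
      deviationBound ζ α β γ x := by
  obtain ⟨l, hl, hexp⟩ := exists_exponent_eq hφ.two_le hβ hγ hx
  refine ⟨l, hl, ?_⟩
  have hx0 : 0 < x := hγ.trans hx
  have hp0 : 0 < γ / x := by positivity
  have h1p : 0 < 1 - γ / x := sub_pos.2 ((div_lt_one hx0).2 hx)
  have h1 := mul_le_mul_of_nonneg_left
    (hφ.le_rpow_div_add (show 0 ≤ l * γ / (1 - γ / x) by positivity)) h1p.le
  have h2 := mul_le_mul_of_nonneg_left
    (hφ.le_rpow_div_add (show 0 ≤ l * β / (1 - γ / x) by positivity)) hp0.le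
  have hmin : 0 < min 1 γ := lt_min one_pos hγ
  rw [deviationBound, ← hexp]
  set e := -(l * x) + ((1 - γ / x) * ((l * γ / (1 - γ / x)) ^ ζ / ζ) +
        γ / x * ((l * β / (1 - γ / x)) ^ ζ / ζ)) with he
  set R := (Real.exp 1 * x / min 1 γ) ^ (1 / α) with hR
  have hR0 : 0 ≤ R := by positivity
  calc _ ≤ Real.exp (e + 1 / 4) * (3 / 2 * R) := by
        refine mul_le_mul (Real.exp_le_exp.2 ?_) ?_ (by positivity) (Real.exp_pos _).le
        · rw [he]
          linarith
        · rw [hR, div_div_eq_mul_div]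
          gcongr
          exact min_le_right 1 γ
    _ = Real.exp e * (Real.exp (1 / 4) * (3 / 2)) * R := by rw [Real.exp_add]; ring
    _ ≤ Real.exp e * 2 * R := by
        gcongr
        exact exp_one_quarter_mul_le
    _ = _ := by ring

end Optimization

/-! ### Two-sided bound and the theorem. -/

/-- Bound for the two-sided deviation of a process that is determined by its values on a countable
set. -/
theorem measure_lt_iSup_abs_le {Ω : Type*} [MeasurableSpace Ω] {P : Measure Ω} {φ : ℝ → ℝ}
    {ζ T C α γ δ : ℝ} (hφ : IsClassI φ ζ) (hT : 0 < T) (hC : 0 < C) (hα : α ∈ Set.Ioo (0 : ℝ) 1)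
    (hγ : 0 < γ) (hδ : γ < δ) {Y : ℝ → Ω → ℝ}
    (hY : ∀ t ∈ Set.Icc 0 T, IsSubPhiBound φ P (Y t) γ)
    (hinc : ∀ h, 0 < h → ∀ t ∈ Set.Icc 0 T, ∀ s ∈ Set.Icc 0 T, |t - s| ≤ h →
      IsSubPhiBound φ P (fun ω => Y t ω - Y s ω) (C * h ^ α))
    {S : Set ℝ} (hS : S.Countable) (hST : S ⊆ Set.Icc 0 T)
    (hdet : ∀ᵐ ω ∂P, (∀ s ∈ S, |Y s ω| ≤ δ) → ∀ t ∈ Set.Icc 0 T, |Y t ω| ≤ δ) :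
    P {ω | (δ : EReal) < ⨆ t ∈ Set.Icc 0 T, ((|Y t ω| : ℝ) : EReal)} ≤
      ENNReal.ofReal (2 * deviationBound ζ α (C * (T / 2) ^ α) γ δ) := by
  have hδ0 : 0 < δ := hγ.trans hδ
  have hp0 : 0 < γ / δ := by positivity
  have hp1 : γ / δ < 1 := (div_lt_one hδ0).2 hδ
  obtain ⟨l, hl, hle⟩ := exists_exponential_bound_le_deviationBound hφ hα.1
    (show 0 < C * (T / 2) ^ α by positivity) hγ hδ
  have hle' := ENNReal.ofReal_le_ofReal hle
  have hpos := (measure_exists_lt_le hφ.nFunction hT hC hα hp0 hp1 hl hY hinc hS hST δ).trans hle'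
  have hneg := (measure_exists_lt_le hφ.nFunction hT hC hα hp0 hp1 hl (Y := fun t ω => -Y t ω)
    (fun t ht => (hY t ht).neg hφ.nFunction)
    (fun h hh t ht s hs hts => by
      have := (hinc h hh t ht s hs hts).neg hφ.nFunction
      convert this using 2 with ω
      ring)
    hS hST δ).trans hle'
  calc _ ≤ P ({ω | ∃ t ∈ S, δ < Y t ω} ∪ {ω | ∃ t ∈ S, δ < -Y t ω}) := by
        refine measure_mono_ae ?_
        filter_upwards [hdet] with ω hω h
        by_contra hmem
        have hcon : ¬((∃ t ∈ S, δ < Y t ω) ∨ ∃ t ∈ S, δ < -Y t ω) := hmem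
        simp only [not_or, not_exists, not_and, not_lt] at hcon
        refine absurd h (not_lt.2 (iSup₂_le fun t ht => EReal.coe_le_coe_iff.2 ?_))
        exact hω (fun s hs => abs_le'.2 ⟨hcon.1 s hs, hcon.2 s hs⟩) t ht
    _ ≤ _ := (measure_union_le _ _).trans (add_le_add hpos hneg)
    _ = _ := by
        rw [← two_mul, ENNReal.ofReal_mul zero_le_two, ENNReal.ofReal_ofNat]

theorem theorem7 {Ω : Type*} [MeasurableSpace Ω] (P : Measure Ω) [IsProbabilityMeasure P]
    (φ : ℝ → ℝ) (ζ : ℝ) (hφ : IsClassI φ ζ)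
    (T C α : ℝ) (hT : 0 < T) (hC : 0 < C) (hα : α ∈ Set.Ioo (0 : ℝ) 1)
    (X : ℝ → Ω → ℝ) (ξ : ℕ → Ω → ℝ) (a : ℕ → ℝ → ℝ) (N : ℕ)
    (hX : ProcessSubPhi φ P T X) (hsep : SeparableProcess P T X)
    (hinc : IncrementsBoundedBy φ P T X (fun h => C * h ^ α))
    (hξ : ∀ k, Measurable (ξ k))
    (hser : HasSeriesRepresentation P T X ξ a)
    (hXN : ProcessSubPhi φ P T (modelProcess ξ a N))
    (hind : iIndepFun ξ P ∨
      IncrementsBoundedBy φ P T (fun t ω => X t ω - modelProcess ξ a N t ω) (fun h => C * h ^ α))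
    (β : ℝ) (hβ : β = C * (T / 2) ^ α)
    (γN : ℝ) (hγpos : 0 < γN)
    (hγ : IsLUB ((fun u => tauPhi φ P (fun ω => X u ω - modelProcess ξ a N u ω) ^ ζ) ''
      Set.Icc 0 T) (γN ^ ζ))
    (δ ν : ℝ) (hδ : accuracyThreshold ζ β γN < δ)
    (hν : 2 * deviationBound ζ α β γN δ ≤ ν) :
    ApproximatesWith P T X (modelProcess ξ a N) ν δ := by
  have hφN := hφ.nFunction
  have hζ : 0 < ζ := by linarith [hφ.two_le]
  have hβ0 : 0 < β := by rw [hβ]; positivity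
  have hincR : IncrementsBoundedBy φ P T (fun t ω => X t ω - modelProcess ξ a N t ω)
      (fun h => C * h ^ α) := by
    rcases hind with hind | hind
    · exact incrementsBoundedBy_remainder_of_iIndepFun hφN hX hinc hξ hser hXN hind
    · exact hind
  obtain ⟨S, hS, hST, hdet⟩ := exists_countable_abs_sub_le_of_separable hsep
    (ae_continuousOn_modelProcess hφN hC hα.1 hX hXN hinc hincR)
  have hR : ∀ t ∈ Set.Icc 0 T, MemSubPhi φ P (fun ω => X t ω - modelProcess ξ a N t ω) :=
    fun t ht => (hX t ht).sub (hXN t ht) hφN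
  refine (measure_lt_iSup_abs_le hφ hT hC hα hγpos
    ((le_accuracyThreshold hβ0 hγpos).trans_lt hδ)
    (Y := fun t ω => X t ω - modelProcess ξ a N t ω) (fun t ht => ?_)
    (fun h hh t ht s hs hts => ?_) hS hST ?_).trans ?_
  · refine (hR t ht).isSubPhiBound hφN ?_
    have := hγ.1 (Set.mem_image_of_mem _ ht)
    exact (Real.rpow_le_rpow_iff ((hR t ht).isSubPhiBound_tauPhi hφN).1 hγpos.le hζ).1 this
  · exact ((hR t ht).sub (hR s hs) hφN).isSubPhiBound hφN (hincR h hh t ht s hs hts)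
  · filter_upwards [hdet] with ω hω
    exact hω δ
  · rw [← hβ]
    exact ENNReal.ofReal_le_ofReal hν
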